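/- **Proposition (Hecke field is $\mathbb{Q}$).** For $N\ge 1$ let $$g(N) = 1 + \frac{\mu}{12} - \frac{\nu_2}{4} - \frac{\nu_3}{3} - \frac{\nu_\infty}{2}$$ denote the value of the genus formula for the modular curve $X_0(N)$, where $\mu = [\mathrm{SL}_2(\mathbb{Z}):\Gamma_0(N)]$, where $\nu_2$ and $\nu_3$ are the numbers of $\Gamma_0(N)$-inequivalent elliptic points of order $2$ and $3$ in the upper half-plane, and where $\nu_\infty$ is the number of $\Gamma_0(N)$-inequivalent cusps. For $N = 11$ one has $\mu = 12$, $\nu_2 = \nu_3 = 0$, $\nu_\infty = 2$, hence $g(11) = 1$, and the complex vector space $S_2(\Gamma_0(11))$ of cusp forms of weight $2$ for $\Gamma_0(11)$ satisfies $$\dim_{\mathbb{C}} S_2(\Gamma_0(11)) = g(11) = 1.$$ There is exactly one normalized newform $f = \sum_{n\ge 1} a_n q^n$ in $S_2(\Gamma_0(11))$, that is, exactly one cusp form with $a_1 = 1$ that is an eigenform of all Hecke operators $T_n$ ($n \ge 1$) and is orthogonal to all oldforms for the Petersson product. Its Fourier coefficients satisfy $a_n \in \mathbb{Z}$ for all $n$,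 so its Hecke field $E = \mathbb{Q}(a_n : n \ge 1) \subseteq \mathbb{C}$ is $\mathbb{Q}$, and $[E:\mathbb{Q}] = 1$. -/

import Mathlib

open UpperHalfPlane CongruenceSubgroup
open scoped MatrixGroups Modular

noncomputable section

namespace HeckeFieldX11

/-- `S_k(Γ₀(N))`, the complex vector space of cusp forms of weight `k` for `Γ₀(N)`. -/
abbrev CuspSpace (N : ℕ) (k : ℤ) : Type :=
  CuspForm ((Gamma0 N : Subgroup SL(2, ℤ)) : Subgroup (GL (Fin 2) ℝ)) k

/-- The `n`-th Fourier coefficient `a_n(f)` in `f(τ) = ∑ a_n(f) exp(2 π i n τ)`. -/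
def fourierCoeff {N : ℕ} {k : ℤ} (f : CuspSpace N k) (n : ℕ) : ℂ :=
  (qExpansion 1 f).coeff n

/-! ### The genus formula for `X₀(N)` -/

/-- The number of elliptic points of order `e` of `Γ₀(N)` (for `e = 2, 3`): the number of
`Γ₀(N)`-orbits in the upper half-plane of points whose stabilizer in `Γ₀(N)` has `2e` elements,
i.e. whose stabilizer in `Γ₀(N) / {±1}` has order `e`. -/
def numEllipticPoints (N e : ℕ) : ℕ :=
  Set.ncard {x : MulAction.orbitRel.Quotient (Gamma0 N) ℍ |
    ∃ τ : ℍ, Quotient.mk (MulAction.orbitRel (Gamma0 N) ℍ) τ = x ∧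
      Nat.card (MulAction.stabilizer (Gamma0 N) τ) = 2 * e}

/-- The number of cusps of `Γ₀(N)` up to `Γ₀(N)`-equivalence. -/
def numCusps (N : ℕ) : ℕ :=
  Nat.card (CuspOrbits ((Gamma0 N : Subgroup SL(2, ℤ)) : Subgroup (GL (Fin 2) ℝ)))

/-- The value `1 + μ / 12 - ν₂ / 4 - ν₃ / 3 - ν_∞ / 2` of the genus formula for `X₀(N)`. -/
def genusFormula (N : ℕ) : ℚ :=
  1 + ((Gamma0 N).index : ℚ) / 12 - (numEllipticPoints N 2 : ℚ) / 4
    - (numEllipticPoints N 3 : ℚ) / 3 - (numCusps N : ℚ) / 2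

/-! ### Hecke operators, old forms, newforms -/

/-- The Hecke operator `T_n` of level `Γ₀(N)` and weight `k` (written `U_p` for `n = p ∣ N`):
`(T_n f)(τ) = n^(k-1) ∑_{ad = n, gcd(a, N) = 1} d^(-k) ∑_{0 ≤ b < d} f((aτ + b) / d)`.
For `n ≥ 1` all arguments lie in the upper half-plane, so `ofComplex` only inserts
the coercion from complex numbers with positive imaginary part to `ℍ`. -/
def heckeT (N : ℕ) (k : ℤ) (n : ℕ) (f : ℍ → ℂ) (τ : ℍ) : ℂ :=
  (n : ℂ) ^ (k - 1) *
    ∑ p ∈ n.divisorsAntidiagonal with Nat.Coprime p.1 N,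
      (p.2 : ℂ) ^ (-k) *
        ∑ b ∈ Finset.range p.2, f (ofComplex (((p.1 : ℂ) * (τ : ℂ) + (b : ℂ)) / (p.2 : ℂ)))

/-- The Petersson product on `S_k(Γ₀(N))` (unnormalized, conjugate-linear in the first variable):
the integral of `conj(f) g y^k` for `dx dy / y²` over the fundamental domain of `Γ₀(N)` formed by
the translates `γ⁻¹ 𝒟`, with `γ` running over representatives of `SL₂(ℤ) / Γ₀(N)`. -/
def peterssonProduct {N : ℕ} {k : ℤ} (f g : CuspSpace N k) : ℂ :=
  ∑ᶠ γ : SL(2, ℤ) ⧸ Gamma0 N, ∫ τ in 𝒟, petersson k f g ((Quotient.out γ)⁻¹ • τ)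

/-- The old subspace of `S_k(Γ₀(N))`: the span of the forms `τ ↦ g(dτ)` with
`g ∈ S_k(Γ₀(M))`, `M` a proper divisor of `N` and `d ∣ N / M`. -/
def oldSubspace (N : ℕ) (k : ℤ) : Submodule ℂ (CuspSpace N k) :=
  Submodule.span ℂ {f | ∃ M ∈ N.properDivisors, ∃ d ∈ (N / M).divisors,
    ∃ g : CuspSpace M k, ∀ τ : ℍ, f τ = g (ofComplex ((d : ℂ) * (τ : ℂ)))}

/-- A (normalized) newform in `S_k(Γ₀(N))`: a simultaneous eigenform of all the Hecke operators
`T_n`, `n ≥ 1`, with `a_1 = 1`, that is Petersson-orthogonal to the old subspace. -/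
structure IsNewform {N : ℕ} {k : ℤ} (f : CuspSpace N k) : Prop where
  normalized : fourierCoeff f 1 = 1
  eigenform : ∀ n : ℕ, 1 ≤ n → ∃ c : ℂ, ∀ τ : ℍ, heckeT N k n f τ = c * f τ
  new : ∀ g ∈ oldSubspace N k, peterssonProduct g f = 0

/-- The Hecke field `ℚ(a_n(f) : n ≥ 1)`, as a subfield of `ℂ`. -/
def heckeField {N : ℕ} {k : ℤ} (f : CuspSpace N k) : IntermediateField ℚ ℂ :=
  IntermediateField.adjoin ℚ {a : ℂ | ∃ n : ℕ, 1 ≤ n ∧ fourierCoeff f n = a}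

end HeckeFieldX11

end

/-!
`S₂(Γ₀(11))` is spanned by the eta quotient `f(τ) = η(τ)² η(11τ)²`, and every assertion about the
newform is read off from this.

* The function `η²` has weight `1` for `SL₂(ℤ)` up to a character of order `12`, and that character
  factors through `SL₂(ℤ/12)` by an explicit formula in the entries (`exists_etaSq_slash`).
  For `(a, b; 11c, d)` in `Γ₀(11)` the second factor `η(11τ)²` contributes the character at
  `(a, 11b; c, d)`. As `11 ≡ -1` modulo `12`, the two contributions cancel, so `f` is invariant
  (`etaQuotient_slash`).
* `Γ₀(11)` has the two cusps `∞` and `0`, of widths `1` and `11`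
  (`exists_mem_Gamma0_cusp_eq`). Since `f¹² = Δ(τ) Δ(11τ)`, the function `f` has no zero in `ℍ` and
  vanishes at both cusps, to order at most one. Hence `g / f` is a modular form of weight `0`
  for every cusp form `g` of weight `2`, thus a constant (`exists_smul_etaForm_eq`).
* Right multiplication by `Γ₀(N)` permutes the cosets `Γ₀(N) (a, b; 0, d)` that define `T_n`, by
  uniqueness of the Hermite normal form, so `T_n` preserves cusp forms (`heckeForm`). On a
  one-dimensional space this makes `f` an eigenform.
* There are no old forms since `S₂(SL₂(ℤ)) = 0` (`oldSubspace_eleven_two`).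
* The `q`-expansion of `f` is a locally uniform limit of polynomials with integral coefficients, and
  the integers are closed in `ℂ` (`exists_int_fourierCoeff_etaForm`).

The numerical data come from three facts: the first column of a matrix classifies the cosets of
`Γ₀(11)` by the `12` points of the projective line over `𝔽₁₁`; an elliptic matrix in `Γ₀(11)` would
give a root of `x² + 1` or of `x² ± x + 1` in `𝔽₁₁`; and `∞` and `0` are inequivalent.
-/

noncomputable section

namespace HeckeFieldX11

/-! ### Cosets, cusps and elliptic points of `Γ₀(11)` -/

section GroupTheory

open Matrix.SpecialLinearGroup

instance fact_prime_eleven : Fact (Nat.Prime 11) := ⟨by norm_num⟩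

lemma det_entries (g : SL(2, ℤ)) : g 0 0 * g 1 1 - g 0 1 * g 1 0 = 1 := by
  have := g.det_coe
  rwa [Matrix.det_fin_two] at this

lemma inv_mul_lower_left (g h : SL(2, ℤ)) :
    (g⁻¹ * h) 1 0 = g 0 0 * h 1 0 - g 1 0 * h 0 0 := by
  rw [coe_mul, coe_inv, Matrix.adjugate_fin_two, Matrix.mul_apply, Fin.sum_univ_two]
  simp
  ring

lemma mul_S_lower_left (g : SL(2, ℤ)) : (g * ModularGroup.S) 1 0 = g 1 1 := by
  rw [coe_mul, ModularGroup.coe_S, Matrix.mul_apply, Fin.sum_univ_two]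
  simp

lemma mapGL_smul_infty_eq_self_iff (g : SL(2, ℤ)) :
    mapGL ℝ g • (OnePoint.infty : OnePoint ℝ) = OnePoint.infty ↔ g 1 0 = 0 := by
  rw [OnePoint.smul_infty_eq_self_iff, mapGL_coe_matrix]
  simp

lemma mem_Gamma0_iff_dvd {N : ℕ} {g : SL(2, ℤ)} : g ∈ Gamma0 N ↔ (N : ℤ) ∣ g 1 0 := by
  rw [Gamma0_mem, ZMod.intCast_zmod_eq_zero_iff_dvd]

/-- The first column of `g`, as the point `a / c` of the projective line over `𝔽₁₁`, with
`none` for the point at infinity. It classifies the left cosets of `Γ₀(11)`. -/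
def columnPoint (g : SL(2, ℤ)) : Option (ZMod 11) :=
  if (g 1 0 : ZMod 11) = 0 then none else some ((g 0 0 : ZMod 11) / (g 1 0 : ZMod 11))

lemma upper_left_ne_zero_of_lower_left_eq_zero {g : SL(2, ℤ)} (hg : (g 1 0 : ZMod 11) = 0) :
    (g 0 0 : ZMod 11) ≠ 0 := by
  intro h
  have := congrArg (Int.cast : ℤ → ZMod 11) (det_entries g)
  push_cast at this
  rw [hg, h] at this
  simp at this

lemma columnPoint_eq_iff (g h : SL(2, ℤ)) :
    columnPoint g = columnPoint h ↔ g⁻¹ * h ∈ Gamma0 11 := by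
  rw [Gamma0_mem, inv_mul_lower_left]
  push_cast
  unfold columnPoint
  by_cases hg : (g 1 0 : ZMod 11) = 0 <;> by_cases hh : (h 1 0 : ZMod 11) = 0
  · simp [hg, hh]
  · simp [hg, hh, upper_left_ne_zero_of_lower_left_eq_zero hg]
  · simp [hg, hh, upper_left_ne_zero_of_lower_left_eq_zero hh]
  · simp only [hg, hh, if_false, Option.some.injEq]
    rw [div_eq_div_iff hg hh, sub_eq_zero, mul_comm (h 0 0 : ZMod 11)]

lemma columnPoint_surjective : Function.Surjective columnPoint := by
  rintro (_ | x)
  · exact ⟨1, by simp [columnPoint]⟩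
  · obtain ⟨n, rfl⟩ := ZMod.intCast_surjective x
    refine ⟨⟨!![n, -1; 1, 0], by simp [Matrix.det_fin_two]⟩, ?_⟩
    simp [columnPoint]

lemma index_Gamma0_eleven : (Gamma0 11).index = 12 := by
  let e : SL(2, ℤ) ⧸ Gamma0 11 → Option (ZMod 11) :=
    Quotient.lift columnPoint fun g h hgh ↦
      (columnPoint_eq_iff g h).2 (QuotientGroup.leftRel_apply.1 hgh)
  have he : Function.Bijective e := by
    refine ⟨?_, fun x ↦ ?_⟩
    · rintro ⟨g⟩ ⟨h⟩ hgh
      exact Quotient.sound (QuotientGroup.leftRel_apply.2 ((columnPoint_eq_iff g h).1 hgh))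
    · obtain ⟨g, rfl⟩ := columnPoint_surjective x
      exact ⟨Quotient.mk _ g, rfl⟩
  rw [Subgroup.index, Nat.card_congr (Equiv.ofBijective e he)]
  simp [Nat.card_eq_fintype_card, ZMod.card]

/-- An element of `Γ₀(11)` fixing a point of `ℍ` is `±1`: otherwise its trace is `0` or `±1`, and
then its upper left entry solves `x² + 1 = 0` or `x² ± x + 1 = 0` modulo `11`, where neither
equation has a root. -/
lemma eq_one_or_eq_neg_one_of_smul_eq {g : SL(2, ℤ)} (hg : g ∈ Gamma0 11) {τ : ℍ}
    (h : g • τ = τ) : g = 1 ∨ g = -1 := by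
  have hdet := det_entries g
  have hfix : (g 0 0 : ℂ) * τ + g 0 1 = τ * ((g 1 0 : ℂ) * τ + g 1 1) := by
    have h1 := congrArg (fun z : ℍ ↦ (z : ℂ)) h
    simp only [UpperHalfPlane.specialLinearGroup_apply] at h1
    have h2 : ((g 1 0 : ℂ) * τ + g 1 1) ≠ 0 := by
      simpa [denom] using denom_ne_zero (g : GL (Fin 2) ℝ) τ
    simp only [algebraMap_int_eq, eq_intCast, Complex.ofReal_intCast] at h1
    rwa [div_eq_iff h2] at h1
  have him := congrArg Complex.im hfix
  have hre := congrArg Complex.re hfix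
  simp at him hre
  have hy := τ.im_pos
  have him' : (g 0 0 : ℝ) - g 1 1 = 2 * g 1 0 * τ.re := by
    have : τ.im * ((g 0 0 : ℝ) - g 1 1 - 2 * g 1 0 * τ.re) = 0 := by
      linear_combination him
    rcases mul_eq_zero.1 this with h0 | h0
    · exact absurd h0 hy.ne'
    · linarith
  have hre' : (g 0 1 : ℝ) = - g 1 0 * (τ.re ^ 2 + τ.im ^ 2) := by
    linear_combination hre - τ.re * him'
  by_cases hc : g 1 0 = 0
  · have h01 : g 0 1 = 0 := by exact_mod_cast (by simpa [hc] using hre' : (g 0 1 : ℝ) = 0)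
    have hd : g 1 1 = g 0 0 := by
      have : (g 0 0 : ℝ) - g 1 1 = 0 := by simpa [hc] using him'
      have : (g 0 0 : ℝ) = g 1 1 := by linarith
      exact_mod_cast this.symm
    have h00 : g 0 0 * g 0 0 = 1 := by rw [h01, hd] at hdet; linarith
    rcases mul_self_eq_one_iff.1 h00 with h1 | h1
    · left; ext i j; fin_cases i <;> fin_cases j <;> simp [h1, h01, hc, hd]
    · right; ext i j; fin_cases i <;> fin_cases j <;> simp [h1, h01, hc, hd]
  · exfalso
    -- The discriminant of the quadratic equation of `τ` is negative.
    have hlt : (g 0 0 + g 1 1) ^ 2 < 4 := by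
      have hpos : 0 < (2 * (g 1 0 : ℝ) * τ.im) ^ 2 := by
        have : (g 1 0 : ℝ) ≠ 0 := by exact_mod_cast hc
        positivity
      have hdetR : (g 0 0 : ℝ) * g 1 1 - g 0 1 * g 1 0 = 1 := by exact_mod_cast hdet
      have : ((g 0 0 : ℝ) + g 1 1) ^ 2 = 4 - (2 * (g 1 0 : ℝ) * τ.im) ^ 2 := by
        linear_combination ((g 0 0 : ℝ) - g 1 1 + 2 * g 1 0 * τ.re) * him' + 4 * hdetR
          + 4 * (g 1 0 : ℝ) * hre'
      have : ((g 0 0 : ℝ) + g 1 1) ^ 2 < 4 := by linarith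
      exact_mod_cast this
    have h11 : (g 1 0 : ZMod 11) = 0 := Gamma0_mem.1 hg
    have hdet' : (g 0 0 : ZMod 11) * g 1 1 = 1 := by
      have := congrArg (Int.cast : ℤ → ZMod 11) hdet
      push_cast at this
      simpa [h11] using this
    have htr : g 0 0 + g 1 1 = -1 ∨ g 0 0 + g 1 1 = 0 ∨ g 0 0 + g 1 1 = 1 := by
      have h1 : -2 < g 0 0 + g 1 1 := by nlinarith
      have h2 : g 0 0 + g 1 1 < 2 := by nlinarith
      omega
    have key : ∀ x y : ZMod 11, x * y = 1 → x + y ≠ -1 ∧ x + y ≠ 0 ∧ x + y ≠ 1 := by decide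
    obtain ⟨k1, k2, k3⟩ := key _ _ hdet'
    rcases htr with h1 | h1 | h1
    · exact k1 (by exact_mod_cast congrArg (Int.cast : ℤ → ZMod 11) h1)
    · exact k2 (by exact_mod_cast congrArg (Int.cast : ℤ → ZMod 11) h1)
    · exact k3 (by exact_mod_cast congrArg (Int.cast : ℤ → ZMod 11) h1)

lemma numEllipticPoints_eleven_eq_zero {e : ℕ} (he : 2 ≤ e) : numEllipticPoints 11 e = 0 := by
  rw [numEllipticPoints, ← Set.ncard_empty]
  congr 1
  refine Set.eq_empty_iff_forall_notMem.2 ?_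
  rintro x ⟨τ, -, hτ⟩
  have hsub : (Subtype.val ∘ Subtype.val : MulAction.stabilizer (Gamma0 11) τ → SL(2, ℤ)) ⁻¹'
      ({1, -1} : Set SL(2, ℤ)) = Set.univ :=
    Set.eq_univ_of_forall fun g ↦ eq_one_or_eq_neg_one_of_smul_eq g.1.2 g.2
  have hinj : Function.Injective
      (Subtype.val ∘ Subtype.val : MulAction.stabilizer (Gamma0 11) τ → SL(2, ℤ)) :=
    Subtype.val_injective.comp Subtype.val_injective
  have hle : Nat.card (MulAction.stabilizer (Gamma0 11) τ) ≤ 2 := by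
    rw [← Set.ncard_univ, ← hsub]
    refine (Set.ncard_le_ncard_of_injOn (t := ({1, -1} : Set SL(2, ℤ)))
      (Subtype.val ∘ Subtype.val) (fun x hx ↦ hx) hinj.injOn (by simp)).trans ?_
    exact (Set.ncard_insert_le _ _).trans (by simp)
  omega

/-- Every cusp of `Γ₀(11)` is equivalent to `∞` or to `S ∞ = 0`. -/
lemma exists_mem_Gamma0_cusp_eq {c : OnePoint ℝ} (hc : IsCusp c 𝒮ℒ) :
    ∃ γ ∈ Gamma0 11, c = mapGL ℝ γ • OnePoint.infty ∨
      c = mapGL ℝ γ • mapGL ℝ ModularGroup.S • OnePoint.infty := by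
  obtain ⟨g, rfl⟩ := isCusp_SL2Z_iff'.1 hc
  by_cases hg : (g 1 0 : ZMod 11) = 0
  · exact ⟨g, Gamma0_mem.2 hg, .inl rfl⟩
  · obtain ⟨j, hj⟩ := ZMod.intCast_surjective ((g 1 1 : ZMod 11) / (g 1 0 : ZMod 11))
    refine ⟨g * ModularGroup.T ^ (-j) * ModularGroup.S⁻¹, ?_, .inr ?_⟩
    · rw [Gamma0_mem]
      have : (g * ModularGroup.T ^ (-j) * ModularGroup.S⁻¹) 1 0 = j * g 1 0 - g 1 1 := by
        simp only [coe_mul, ModularGroup.coe_T_zpow, coe_inv, ModularGroup.coe_S,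
          Matrix.adjugate_fin_two, Matrix.mul_apply, Fin.sum_univ_two]
        simp
        ring
      rw [this]
      push_cast
      rw [hj, div_mul_cancel₀ _ hg, sub_self]
    · have hT : mapGL ℝ (ModularGroup.T ^ (-j)) • (OnePoint.infty : OnePoint ℝ)
          = OnePoint.infty := by
        rw [mapGL_smul_infty_eq_self_iff, ModularGroup.coe_T_zpow]
        simp
      rw [← mul_smul, ← map_mul, inv_mul_cancel_right, map_mul, mul_smul, hT]

lemma numCusps_eleven : numCusps 11 = 2 := by
  have hcusp (c : OnePoint ℝ) : IsCusp c ((Gamma0 11 : Subgroup SL(2, ℤ)) :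
      Subgroup (GL (Fin 2) ℝ)) ↔ IsCusp c 𝒮ℒ :=
    Subgroup.IsArithmetic.isCusp_iff_isCusp_SL2Z _
  have h1 : IsCusp (OnePoint.infty : OnePoint ℝ) 𝒮ℒ := isCusp_SL2Z_iff'.2 ⟨1, by simp⟩
  have h2 : IsCusp (mapGL ℝ ModularGroup.S • OnePoint.infty : OnePoint ℝ) 𝒮ℒ :=
    isCusp_SL2Z_iff'.2 ⟨_, rfl⟩
  rw [numCusps, Nat.card_eq_two_iff]
  refine ⟨Quotient.mk _ ⟨_, (hcusp _).2 h1⟩, Quotient.mk _ ⟨_, (hcusp _).2 h2⟩, ?_, ?_⟩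
  · intro h
    obtain ⟨⟨_, γ, hγ, rfl⟩, hγ'⟩ := Quotient.exact h
    have h3 : mapGL ℝ γ • mapGL ℝ ModularGroup.S • (OnePoint.infty : OnePoint ℝ)
        = OnePoint.infty := congrArg Subtype.val hγ'
    rw [← mul_smul, ← map_mul, mapGL_smul_infty_eq_self_iff, mul_S_lower_left] at h3
    have h6 := congrArg (Int.cast : ℤ → ZMod 11) (det_entries γ)
    have h7 : (γ 1 0 : ZMod 11) = 0 := Gamma0_mem.1 hγ
    push_cast at h6
    simp [h3, h7] at h6
  · refine Set.eq_univ_of_forall ?_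
    rintro ⟨c, hc⟩
    obtain ⟨γ, hγ, rfl | rfl⟩ := exists_mem_Gamma0_cusp_eq ((hcusp _).1 hc)
    · exact .inl (Quotient.sound ⟨⟨_, γ, hγ, rfl⟩, rfl⟩)
    · exact .inr (Quotient.sound ⟨⟨_, γ, hγ, rfl⟩, rfl⟩)

lemma genusFormula_eleven : genusFormula 11 = 1 := by
  rw [genusFormula, index_Gamma0_eleven, numEllipticPoints_eleven_eq_zero le_rfl,
    numEllipticPoints_eleven_eq_zero (by norm_num), numCusps_eleven]
  norm_num

end GroupTheory

/-! ### The square of the Dedekind eta function under `SL₂(ℤ)` -/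

section Eta

open Complex ModularForm Matrix.SpecialLinearGroup
open scoped Real

/-- The square `η²` of the Dedekind eta function, as a function on `ℍ`. -/
def etaSq (τ : ℍ) : ℂ := η τ ^ 2

lemma etaSq_ne_zero (τ : ℍ) : etaSq τ ≠ 0 := pow_ne_zero _ (eta_ne_zero τ.2)

lemma etaSq_pow_twelve (τ : ℍ) : etaSq τ ^ 12 = ModularForm.discriminant τ := by
  rw [etaSq, ← pow_mul, ModularForm.discriminant]

/-- The primitive twelfth root of unity by which `T` acts on `η²`. -/
def zeta12 : ℂ := exp (2 * π * Complex.I / 12)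

lemma zeta12_ne_zero : zeta12 ≠ 0 := exp_ne_zero _

lemma zeta12_pow_twelve : zeta12 ^ 12 = 1 := by
  rw [zeta12, ← exp_nat_mul]
  convert exp_two_pi_mul_I using 2
  push_cast
  ring

lemma zeta12_pow_three : zeta12 ^ 3 = Complex.I := by
  rw [zeta12, ← exp_nat_mul, show ((3 : ℕ) : ℂ) * (2 * π * Complex.I / 12) = π / 2 * Complex.I by
    push_cast; ring, exp_pi_div_two_mul_I]

lemma etaSq_slash_T : etaSq ∣[(1 : ℤ)] ModularGroup.T = zeta12 • etaSq := by
  ext τ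
  rw [SL_slash_apply, modular_T_smul]
  have h1 : denom ModularGroup.T τ = 1 := by
    rw [ModularGroup.denom_apply, ModularGroup.coe_T]
    simp
  have h2 (n : ℕ) : eta_q n ((1 : ℝ) + τ : ℂ) = eta_q n τ := by
    rw [eta_q_eq_pow, eta_q_eq_pow]
    congr 1
    rw [mul_add, exp_add]
    simp
  rw [h1]
  simp only [etaSq, ModularForm.eta, one_zpow, mul_one, Pi.smul_apply, smul_eq_mul, coe_vadd, h2]
  rw [mul_pow, mul_pow, ← mul_assoc]
  congr 1
  rw [zeta12, Function.Periodic.qParam, Function.Periodic.qParam, ← exp_nat_mul, ← exp_nat_mul,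
    ← exp_add]
  congr 1
  push_cast
  ring

lemma etaSq_slash_S : etaSq ∣[(1 : ℤ)] ModularGroup.S = (-Complex.I) • etaSq := by
  ext τ
  have h1 : η (-(τ : ℂ)⁻¹) = (sqrt Complex.I)⁻¹ * (sqrt τ * η τ) := by
    simpa [neg_div] using eta_comp_eq_csqrt_I_inv τ.2
  have h2 (z : ℂ) : sqrt z ^ 2 = z := by simp [sqrt]
  rw [SL_slash_apply, modular_S_smul, ModularGroup.denom_S]
  simp only [etaSq, Pi.smul_apply, smul_eq_mul]
  have h3 : η ((UpperHalfPlane.mk (-(τ : ℂ))⁻¹ τ.im_inv_neg_coe_pos : ℍ) : ℂ)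
    = η (-(τ : ℂ)⁻¹) := by simp [inv_neg]
  rw [h3, h1, mul_pow, mul_pow, inv_pow, h2, h2]
  have := τ.ne_zero
  simp
  field_simp

/-- Modulo `3`, the exponent of `zeta12` by which a matrix of `SL₂(ℤ)` acts on `η²`, in terms of
the entries of the matrix. -/
def multiplierMod3 (a b c d : ZMod 3) : ZMod 3 := (1 - c ^ 2) * (b * d) + c * (a + d)

/-- Modulo `4`, the exponent of `zeta12` by which a matrix of `SL₂(ℤ)` acts on `η²`, in terms of
the entries of the matrix. -/
def multiplierMod4 (a b c d : ZMod 4) : ZMod 4 :=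
  (1 - c ^ 2) * (b * d - (c - 1) * d + c - 1) + c * (a + d + 1)

/-! The four lemmas below give the effect of `S^{±1}` and `T^{±1}` on the exponents. -/

lemma multiplierMod3_mul_S : ∀ a b c d : ZMod 3, a * d - b * c = 1 →
    multiplierMod3 b (-a) d (-c) = multiplierMod3 a b c d - 3 ∧
    multiplierMod3 (-b) a (-d) c = multiplierMod3 a b c d + 3 := by
  unfold multiplierMod3
  decide

lemma multiplierMod3_mul_T : ∀ a b c d : ZMod 3, a * d - b * c = 1 →
    multiplierMod3 a (a + b) c (c + d) = multiplierMod3 a b c d + 1 ∧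
    multiplierMod3 a (-a + b) c (-c + d) = multiplierMod3 a b c d - 1 := by
  unfold multiplierMod3
  decide

set_option maxRecDepth 4000 in
lemma multiplierMod4_mul_S : ∀ a b c d : ZMod 4, a * d - b * c = 1 →
    multiplierMod4 b (-a) d (-c) = multiplierMod4 a b c d - 3 ∧
    multiplierMod4 (-b) a (-d) c = multiplierMod4 a b c d + 3 := by
  unfold multiplierMod4
  decide

set_option maxRecDepth 4000 in
lemma multiplierMod4_mul_T : ∀ a b c d : ZMod 4, a * d - b * c = 1 →
    multiplierMod4 a (a + b) c (c + d) = multiplierMod4 a b c d + 1 ∧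
    multiplierMod4 a (-a + b) c (-c + d) = multiplierMod4 a b c d - 1 := by
  unfold multiplierMod4
  decide

lemma coe_mul_S (x : SL(2, ℤ)) : ((x * ModularGroup.S : SL(2, ℤ)) : Matrix (Fin 2) (Fin 2) ℤ) =
    !![x 0 1, -x 0 0; x 1 1, -x 1 0] := by
  rw [Matrix.SpecialLinearGroup.coe_mul, ModularGroup.coe_S]
  ext i j
  fin_cases i <;> fin_cases j <;> simp [Matrix.mul_apply, Fin.sum_univ_two]

lemma coe_mul_S_inv (x : SL(2, ℤ)) :
    ((x * ModularGroup.S⁻¹ : SL(2, ℤ)) : Matrix (Fin 2) (Fin 2) ℤ) =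
      !![-x 0 1, x 0 0; -x 1 1, x 1 0] := by
  rw [Matrix.SpecialLinearGroup.coe_mul, coe_inv, ModularGroup.coe_S, Matrix.adjugate_fin_two]
  ext i j
  fin_cases i <;> fin_cases j <;> simp [Matrix.mul_apply, Fin.sum_univ_two]

lemma coe_mul_T_zpow (x : SL(2, ℤ)) (n : ℤ) :
    ((x * ModularGroup.T ^ n : SL(2, ℤ)) : Matrix (Fin 2) (Fin 2) ℤ) =
      !![x 0 0, n * x 0 0 + x 0 1; x 1 0, n * x 1 0 + x 1 1] := by
  rw [Matrix.SpecialLinearGroup.coe_mul, ModularGroup.coe_T_zpow]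
  ext i j
  fin_cases i <;> fin_cases j <;> simp [Matrix.mul_apply, Fin.sum_univ_two, mul_comm]

/-- The multiplier system of `η²`, a character of `SL₂(ℤ)` of order `12` that factors through
`SL₂(ℤ/12)`. -/
lemma exists_etaSq_slash (γ : SL(2, ℤ)) :
    ∃ n : ℤ, etaSq ∣[(1 : ℤ)] γ = zeta12 ^ n • etaSq ∧
      (n : ZMod 3) = multiplierMod3 (γ 0 0) (γ 0 1) (γ 1 0) (γ 1 1) ∧
      (n : ZMod 4) = multiplierMod4 (γ 0 0) (γ 0 1) (γ 1 0) (γ 1 1) := by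
  have hS : etaSq ∣[(1 : ℤ)] ModularGroup.S = zeta12 ^ (-3 : ℤ) • etaSq := by
    rw [etaSq_slash_S, zpow_neg]
    congr 1
    rw [show zeta12 ^ (3 : ℤ) = zeta12 ^ 3 by norm_cast, zeta12_pow_three, Complex.inv_I]
  have hT : etaSq ∣[(1 : ℤ)] ModularGroup.T = zeta12 ^ (1 : ℤ) • etaSq := by
    rw [etaSq_slash_T, zpow_one]
  have step {γ g : SL(2, ℤ)} {n m : ℤ} (h1 : etaSq ∣[(1 : ℤ)] γ = zeta12 ^ n • etaSq)
      (h2 : etaSq ∣[(1 : ℤ)] g = zeta12 ^ m • etaSq) :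
      etaSq ∣[(1 : ℤ)] (γ * g) = zeta12 ^ (n + m) • etaSq := by
    rw [SlashAction.slash_mul, h1, SL_smul_slash, h2, smul_smul, zpow_add₀ zeta12_ne_zero]
  have inv {g : SL(2, ℤ)} {m : ℤ} (h : etaSq ∣[(1 : ℤ)] g = zeta12 ^ m • etaSq) :
      etaSq ∣[(1 : ℤ)] g⁻¹ = zeta12 ^ (-m) • etaSq := by
    have h1 := congrArg (zeta12 ^ (-m) • · ∣[(1 : ℤ)] g⁻¹) h
    simp only [← SlashAction.slash_mul, mul_inv_cancel, SlashAction.slash_one,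
      SL_smul_slash, smul_smul, ← zpow_add₀ zeta12_ne_zero] at h1
    simpa using h1.symm
  have det3 (γ : SL(2, ℤ)) : (γ 0 0 * γ 1 1 - γ 0 1 * γ 1 0 : ZMod 3) = 1 := by
    exact_mod_cast congrArg (Int.cast : ℤ → ZMod 3) (det_entries γ)
  have det4 (γ : SL(2, ℤ)) : (γ 0 0 * γ 1 1 - γ 0 1 * γ 1 0 : ZMod 4) = 1 := by
    exact_mod_cast congrArg (Int.cast : ℤ → ZMod 4) (det_entries γ)
  have hγ : γ ∈ Subgroup.closure {ModularGroup.S, ModularGroup.T} := by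
    simp [SpecialLinearGroup.SL2Z_generators]
  induction hγ using Subgroup.closure_induction_right with
  | one => exact ⟨0, by simp, by decide, by decide⟩
  | mul_right x _ y hy ih =>
    obtain ⟨n, h1, h3, h4⟩ := ih
    rcases hy with rfl | rfl
    · refine ⟨_, step h1 hS, ?_, ?_⟩
      · push_cast
        rw [h3, coe_mul_S]
        simpa [sub_eq_add_neg] using (multiplierMod3_mul_S _ _ _ _ (det3 x)).1.symm
      · push_cast
        rw [h4, coe_mul_S]
        simpa [sub_eq_add_neg] using (multiplierMod4_mul_S _ _ _ _ (det4 x)).1.symm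
    · have := coe_mul_T_zpow x 1
      rw [zpow_one] at this
      refine ⟨_, step h1 hT, ?_, ?_⟩
      · simpa [h3, this] using (multiplierMod3_mul_T _ _ _ _ (det3 x)).1.symm
      · simpa [h4, this] using (multiplierMod4_mul_T _ _ _ _ (det4 x)).1.symm
  | mul_inv_cancel x _ y hy ih =>
    obtain ⟨n, h1, h3, h4⟩ := ih
    rcases hy with rfl | rfl
    · refine ⟨_, step h1 (inv hS), ?_, ?_⟩
      · push_cast
        rw [h3, coe_mul_S_inv]
        simpa [sub_eq_add_neg] using (multiplierMod3_mul_S _ _ _ _ (det3 x)).2.symm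
      · push_cast
        rw [h4, coe_mul_S_inv]
        simpa [sub_eq_add_neg] using (multiplierMod4_mul_S _ _ _ _ (det4 x)).2.symm
    · have := coe_mul_T_zpow x (-1)
      rw [zpow_neg_one] at this
      refine ⟨_, step h1 (inv hT), ?_, ?_⟩
      · simpa [h3, this, sub_eq_add_neg] using (multiplierMod3_mul_T _ _ _ _ (det3 x)).2.symm
      · simpa [h4, this, sub_eq_add_neg] using (multiplierMod4_mul_T _ _ _ _ (det4 x)).2.symm

/-! ### The eta quotient `η(τ)² η(11τ)²` -/

/-- The matrix `(a, 11b; c/11, d)` attached to `(a, b; c, d)` in `Γ₀(11)`: its conjugate by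
`τ ↦ 11τ`. -/
lemma exists_conj_scale {γ : SL(2, ℤ)} (hγ : γ ∈ Gamma0 11) : ∃ γ' : SL(2, ℤ),
    γ' 0 0 = γ 0 0 ∧ γ' 0 1 = 11 * γ 0 1 ∧ 11 * γ' 1 0 = γ 1 0 ∧ γ' 1 1 = γ 1 1 := by
  obtain ⟨c, hc⟩ := mem_Gamma0_iff_dvd.1 hγ
  have := det_entries γ
  refine ⟨⟨!![γ 0 0, 11 * γ 0 1; c, γ 1 1], ?_⟩, by simp, by simp, by simp [hc], by simp⟩
  rw [Matrix.det_fin_two_of]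
  rw [hc] at this
  push_cast at this
  linarith

/-- The dilation `τ ↦ 11 τ` of the upper half-plane. -/
def scale11 (τ : ℍ) : ℍ := (⟨11, by norm_num⟩ : {x : ℝ // 0 < x}) • τ

/-- The dilation `τ ↦ τ / 11` of the upper half-plane. -/
def scaleInv11 (τ : ℍ) : ℍ := (⟨11⁻¹, by norm_num⟩ : {x : ℝ // 0 < x}) • τ

@[simp] lemma coe_scale11 (τ : ℍ) : (scale11 τ : ℂ) = 11 * τ := by
  simp [scale11]

@[simp] lemma coe_scaleInv11 (τ : ℍ) : (scaleInv11 τ : ℂ) = τ / 11 := by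
  simp [scaleInv11]
  ring

/-- The eta quotient `η(τ)² η(11τ)²`. -/
def etaQuotient (τ : ℍ) : ℂ := etaSq τ * etaSq (scale11 τ)

lemma etaQuotient_ne_zero (τ : ℍ) : etaQuotient τ ≠ 0 :=
  mul_ne_zero (etaSq_ne_zero _) (etaSq_ne_zero _)

lemma multiplier_conj_mod3 : ∀ a b c d : ZMod 3,
    multiplierMod3 a b (11 * c) d + multiplierMod3 a (11 * b) c d = 0 := by
  unfold multiplierMod3
  decide

set_option maxRecDepth 4000 in
lemma multiplier_conj_mod4 : ∀ a b c d : ZMod 4, a * d - 11 * b * c = 1 →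
    multiplierMod4 a b (11 * c) d + multiplierMod4 a (11 * b) c d = 0 := by
  unfold multiplierMod4
  decide

/-- Since `11 ≡ -1` modulo `12`, the multipliers of the two factors of `η(τ)² η(11τ)²` cancel. -/
lemma etaQuotient_slash {γ : SL(2, ℤ)} (hγ : γ ∈ Gamma0 11) :
    etaQuotient ∣[(2 : ℤ)] γ = etaQuotient := by
  obtain ⟨γ', h00, h01, h10, h11⟩ := exists_conj_scale hγ
  obtain ⟨n, hn, hn3, hn4⟩ := exists_etaSq_slash γ
  obtain ⟨m, hm, hm3, hm4⟩ := exists_etaSq_slash γ'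
  -- The exponents of the two characters add up to `0` modulo `3` and modulo `4`.
  have hdvd : (12 : ℤ) ∣ n + m := by
    have h3 : (3 : ℤ) ∣ n + m := by
      refine (ZMod.intCast_zmod_eq_zero_iff_dvd _ 3).1 ?_
      push_cast
      rw [hn3, hm3, h00, h01, h11, ← h10]
      push_cast
      exact multiplier_conj_mod3 _ _ _ _
    have h4 : (4 : ℤ) ∣ n + m := by
      refine (ZMod.intCast_zmod_eq_zero_iff_dvd _ 4).1 ?_
      push_cast
      rw [hn4, hm4, h00, h01, h11, ← h10]
      push_cast
      refine multiplier_conj_mod4 _ _ _ _ ?_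
      have := det_entries γ'
      rw [h00, h01, h11] at this
      exact_mod_cast congrArg (Int.cast : ℤ → ZMod 4) this
    omega
  have hone : zeta12 ^ n * zeta12 ^ m = 1 := by
    obtain ⟨k, hk⟩ := hdvd
    rw [← zpow_add₀ zeta12_ne_zero, hk, zpow_mul,
      show zeta12 ^ (12 : ℤ) = zeta12 ^ 12 by norm_cast, zeta12_pow_twelve, one_zpow]
  have hden (τ : ℍ) : denom γ' (scale11 τ) = denom γ τ := by
    rw [ModularGroup.denom_apply, ModularGroup.denom_apply, coe_scale11, h11, ← h10]
    push_cast
    ring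
  have hscale (τ : ℍ) : scale11 (γ • τ) = γ' • scale11 τ := by
    refine UpperHalfPlane.ext ?_
    have h1 := denom_ne_zero γ τ
    have h2 := hden τ
    rw [ModularGroup.denom_apply] at h1
    rw [ModularGroup.denom_apply, ModularGroup.denom_apply, coe_scale11] at h2
    simp only [coe_scale11, UpperHalfPlane.specialLinearGroup_apply, algebraMap_int_eq,
      eq_intCast, ofReal_intCast]
    rw [h2, h00, h01]
    push_cast
    field_simp
  ext τ
  have e1 := congrFun hn τ
  have e2 := congrFun hm (scale11 τ)
  rw [SL_slash_apply] at e1 e2 ⊢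
  rw [hden] at e2
  simp only [Pi.smul_apply, smul_eq_mul, zpow_neg, zpow_one] at e1 e2
  rw [etaQuotient, hscale, etaQuotient, zpow_neg]
  have hd : denom γ τ ^ (2 : ℤ) = denom γ τ * denom γ τ := by
    rw [zpow_ofNat, sq]
  rw [hd, mul_inv]
  linear_combination (etaSq (γ' • scale11 τ) * (denom γ τ)⁻¹) * e1 +
    (zeta12 ^ n * etaSq τ) * e2 + etaSq τ * etaSq (scale11 τ) * hone

lemma etaQuotient_slash_S (τ : ℍ) : (etaQuotient ∣[(2 : ℤ)] ModularGroup.S) τ =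
    -(11 : ℂ)⁻¹ * (etaSq τ * etaSq (scaleInv11 τ)) := by
  have e1 := congrFun etaSq_slash_S τ
  have e2 := congrFun etaSq_slash_S (scaleInv11 τ)
  rw [SL_slash_apply, ModularGroup.denom_S] at e1 e2 ⊢
  have hscale : scale11 (ModularGroup.S • τ) = ModularGroup.S • scaleInv11 τ := by
    refine UpperHalfPlane.ext ?_
    rw [coe_scale11, modular_S_smul, modular_S_smul]
    simp
    field_simp
  rw [etaQuotient, hscale]
  have := τ.ne_zero
  simp only [Pi.smul_apply, smul_eq_mul, zpow_neg, zpow_one, coe_scaleInv11, inv_div] at e1 e2 ⊢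
  rw [show (τ : ℂ) ^ (2 : ℤ) = τ * τ by rw [zpow_ofNat, sq], mul_inv]
  field_simp at e1 e2 ⊢
  linear_combination (11 * etaSq (ModularGroup.S • scaleInv11 τ)) * e1 +
    (-Complex.I * τ * etaSq τ) * e2 + τ ^ 2 * etaSq τ * etaSq (scaleInv11 τ) * I_sq

end Eta

/-! ### Growth of the eta quotient at the two cusps -/

section Growth

open Complex ModularForm Matrix.SpecialLinearGroup Asymptotics Filter
open scoped Real Topology Manifold

lemma mdifferentiable_etaQuotient : MDiff etaQuotient := by
  rw [UpperHalfPlane.mdifferentiable_iff]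
  have h (z : ℂ) (hz : z ∈ upperHalfPlaneSet) : 11 * z ∈ upperHalfPlaneSet := by
    simpa [upperHalfPlaneSet] using hz
  refine DifferentiableOn.congr (f := fun z ↦ η z ^ 2 * η (11 * z) ^ 2) (fun z hz ↦ ?_)
    fun z hz ↦ ?_
  · have h1 := differentiableAt_eta_of_mem_upperHalfPlaneSet hz
    have h2 : DifferentiableAt ℂ (fun z ↦ η (11 * z)) z :=
      (differentiableAt_eta_of_mem_upperHalfPlaneSet (h z hz)).comp z (by fun_prop)
    exact ((h1.pow 2).mul (h2.pow 2)).differentiableWithinAt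
  · simp [etaQuotient, etaSq, ofComplex_apply_of_im_pos hz]

lemma im_scale11 (τ : ℍ) : (scale11 τ).im = 11 * τ.im := by
  simp [scale11]

lemma im_scaleInv11 (τ : ℍ) : (scaleInv11 τ).im = τ.im / 11 := by
  simp [scaleInv11]
  ring

lemma tendsto_scale11 : Tendsto scale11 atImInfty atImInfty := by
  refine tendsto_comap_iff.2 ?_
  have : Tendsto (fun τ : ℍ ↦ 11 * τ.im) atImInfty atTop :=
    tendsto_comap.const_mul_atTop (by norm_num)
  exact this.congr fun τ ↦ (im_scale11 τ).symm

lemma tendsto_scaleInv11 : Tendsto scaleInv11 atImInfty atImInfty := by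
  refine tendsto_comap_iff.2 ?_
  have : Tendsto (fun τ : ℍ ↦ τ.im / 11) atImInfty atTop :=
    tendsto_comap.atTop_div_const (by norm_num)
  exact this.congr fun τ ↦ (im_scaleInv11 τ).symm

lemma tendsto_etaSq : Tendsto etaSq atImInfty (𝓝 0) := by
  have h : (fun τ ↦ etaSq τ ^ 12) =o[atImInfty] fun _ ↦ (1 : ℂ) ^ 12 := by
    simp only [one_pow, isLittleO_one_iff, etaSq_pow_twelve]
    exact discriminant_isZeroAtImInfty
  exact (isLittleO_one_iff ℂ).1 (h.of_pow (by norm_num))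

lemma isZeroAtImInfty_etaQuotient : IsZeroAtImInfty etaQuotient := by
  have := tendsto_etaSq.mul (tendsto_etaSq.comp tendsto_scale11)
  rwa [mul_zero] at this

lemma isZeroAtImInfty_etaQuotient_slash_S :
    IsZeroAtImInfty (etaQuotient ∣[(2 : ℤ)] ModularGroup.S) := by
  have := (tendsto_etaSq.mul (tendsto_etaSq.comp tendsto_scaleInv11)).const_mul (-(11 : ℂ)⁻¹)
  rw [mul_zero, mul_zero] at this
  exact this.congr fun τ ↦ (etaQuotient_slash_S τ).symm

/-- At `∞` the eta quotient vanishes to order at most one. -/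
lemma exp_isBigO_etaQuotient :
    (fun τ : ℍ ↦ Real.exp (-2 * π * τ.im)) =O[atImInfty] etaQuotient := by
  have h := exp_isBigO_discriminant.mul (exp_isBigO_discriminant.comp_tendsto tendsto_scale11)
  refine IsBigO.of_pow (n := 12) (by norm_num) (h.congr' ?_ ?_)
  · refine .of_forall fun τ ↦ ?_
    simp only [Function.comp_apply, Pi.pow_apply, ← Real.exp_add, ← Real.exp_nat_mul, im_scale11]
    congr 1
    push_cast
    ring
  · refine .of_forall fun τ ↦ ?_
    simp only [Function.comp_apply, Pi.pow_apply, etaQuotient, mul_pow, etaSq_pow_twelve]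

/-- At the cusp `0`, of width `11`, the eta quotient vanishes to order at most one. -/
lemma exp_isBigO_etaQuotient_slash_S : (fun τ : ℍ ↦ Real.exp (-2 * π * τ.im / 11)) =O[atImInfty]
    (etaQuotient ∣[(2 : ℤ)] ModularGroup.S) := by
  have h := exp_isBigO_discriminant.mul (exp_isBigO_discriminant.comp_tendsto tendsto_scaleInv11)
  have h' : (fun τ : ℍ ↦ Real.exp (-2 * π * τ.im / 11)) =O[atImInfty]
      fun τ ↦ etaSq τ * etaSq (scaleInv11 τ) := by
    refine IsBigO.of_pow (n := 12) (by norm_num) (h.congr' ?_ ?_)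
    · refine .of_forall fun τ ↦ ?_
      simp only [Function.comp_apply, Pi.pow_apply, ← Real.exp_add, ← Real.exp_nat_mul,
        im_scaleInv11]
      congr 1
      push_cast
      ring
    · refine .of_forall fun τ ↦ ?_
      simp only [Function.comp_apply, Pi.pow_apply, mul_pow, etaSq_pow_twelve]
  refine h'.trans ?_
  refine (isBigO_const_mul_self (-(11 : ℂ)) (etaQuotient ∣[(2 : ℤ)] ModularGroup.S) _).congr' ?_
    .rfl
  refine .of_forall fun τ ↦ ?_
  simp only [etaQuotient_slash_S]
  ring

/-- The eta quotient `η(τ)² η(11τ)²` as a cusp form of weight `2` for `Γ₀(11)`. -/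
def etaForm : CuspSpace 11 2 where
  toFun := etaQuotient
  slash_action_eq' := by
    rintro _ ⟨γ, hγ, rfl⟩
    exact etaQuotient_slash hγ
  holo' := mdifferentiable_etaQuotient
  zero_at_cusps' {c} hc := by
    rw [Subgroup.IsArithmetic.isCusp_iff_isCusp_SL2Z] at hc
    obtain ⟨γ, hγ, rfl | rfl⟩ := exists_mem_Gamma0_cusp_eq hc
    · rw [OnePoint.IsZeroAt.smul_iff, OnePoint.isZeroAt_infty_iff]
      exact (etaQuotient_slash hγ).symm ▸ isZeroAtImInfty_etaQuotient
    · rw [OnePoint.IsZeroAt.smul_iff, OnePoint.IsZeroAt.smul_iff, OnePoint.isZeroAt_infty_iff]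
      exact (etaQuotient_slash hγ).symm ▸ isZeroAtImInfty_etaQuotient_slash_S

@[simp] lemma coe_etaForm : (etaForm : ℍ → ℂ) = etaQuotient := rfl

lemma slash_eq_self (g : CuspSpace 11 2) {γ : SL(2, ℤ)} (hγ : γ ∈ Gamma0 11) :
    (g : ℍ → ℂ) ∣[(2 : ℤ)] γ = g :=
  SlashInvariantFormClass.slash_action_eq g _ ⟨γ, hγ, rfl⟩

/-- A cusp form of weight `2` for `Γ₀(11)` vanishes at the cusp `0 = S ∞`. -/
lemma isZeroAtImInfty_slash_S (g : CuspSpace 11 2) :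
    IsZeroAtImInfty ((g : ℍ → ℂ) ∣[(2 : ℤ)] ModularGroup.S) := by
  have hc : IsCusp (mapGL ℝ ModularGroup.S • OnePoint.infty : OnePoint ℝ) 𝒮ℒ :=
    isCusp_SL2Z_iff'.2 ⟨_, rfl⟩
  rw [← Subgroup.IsArithmetic.isCusp_iff_isCusp_SL2Z
    ((Gamma0 11 : Subgroup SL(2, ℤ)) : Subgroup (GL (Fin 2) ℝ))] at hc
  exact CuspFormClass.zero_at_cusps g hc _ rfl

/-- The cusp `0` has width `11`: `S T¹¹ S⁻¹` lies in `Γ₀(11)`. -/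
lemma slash_S_vadd (g : CuspSpace 11 2) (τ : ℍ) :
    ((g : ℍ → ℂ) ∣[(2 : ℤ)] ModularGroup.S) ((11 : ℝ) +ᵥ τ) =
      ((g : ℍ → ℂ) ∣[(2 : ℤ)] ModularGroup.S) τ := by
  have hmem : ModularGroup.S * ModularGroup.T ^ (11 : ℤ) * ModularGroup.S⁻¹ ∈ Gamma0 11 := by
    rw [Gamma0_mem]
    rw [coe_mul_S_inv, coe_mul_T_zpow, ModularGroup.coe_S]
    simp
    rfl
  have h : ((g : ℍ → ℂ) ∣[(2 : ℤ)] ModularGroup.S) ∣[(2 : ℤ)] (ModularGroup.T ^ (11 : ℤ)) =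
      (g : ℍ → ℂ) ∣[(2 : ℤ)] ModularGroup.S := by
    conv_rhs => rw [← slash_eq_self g hmem]
    simp only [← SlashAction.slash_mul, inv_mul_cancel_right]
  have h' := congrFun h τ
  rw [SL_slash_apply, modular_T_zpow_smul, ModularGroup.denom_apply, ModularGroup.coe_T_zpow] at h'
  simpa using h'

lemma slash_S_isBigO_exp (g : CuspSpace 11 2) :
    ((g : ℍ → ℂ) ∣[(2 : ℤ)] ModularGroup.S) =O[atImInfty]
      fun τ : ℍ ↦ Real.exp (-2 * π * τ.im / 11) := by
  have hz := isZeroAtImInfty_slash_S g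
  refine hz.exp_decay_atImInfty (by norm_num) ?_ ?_ hz.isBoundedAtImInfty
  · intro z
    by_cases! hz : 0 < z.im
    · have hz' : 0 < (z + (11 : ℝ)).im := by simpa using hz
      simp only [Function.comp_apply, ofComplex_apply_of_im_pos hz',
        ofComplex_apply_of_im_pos hz]
      convert! slash_S_vadd g ⟨z, hz⟩ using 2
      ext
      simp [add_comm]
    · have hz' : (z + (11 : ℝ)).im ≤ 0 := by simpa using hz
      simp only [Function.comp_apply, ofComplex_apply_of_im_nonpos hz',
        ofComplex_apply_of_im_nonpos hz]
  · exact (CuspFormClass.holo g).slash 2 _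

lemma isBigO_exp (g : CuspSpace 11 2) :
    (g : ℍ → ℂ) =O[atImInfty] fun τ : ℍ ↦ Real.exp (-2 * π * τ.im) := by
  simpa using CuspFormClass.exp_decay_atImInfty (h := 1) g one_pos (by simp)

/-- The quotient of a cusp form of weight `2` for `Γ₀(11)` by the eta quotient: the latter has no
zeros in `ℍ` and only simple zeros at the two cusps. -/
def divEtaForm (g : CuspSpace 11 2) :
    ModularForm ((Gamma0 11 : Subgroup SL(2, ℤ)) : Subgroup (GL (Fin 2) ℝ)) 0 where
  toFun := g / etaQuotient
  slash_action_eq' := by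
    rintro _ ⟨γ, hγ, rfl⟩
    have := div_slash_SL2 2 2 γ g etaQuotient
    rwa [slash_eq_self g hγ, etaQuotient_slash hγ] at this
  holo' := (CuspFormClass.holo g).div mdifferentiable_etaQuotient etaQuotient_ne_zero
  bdd_at_cusps' {c} hc := by
    rw [Subgroup.IsArithmetic.isCusp_iff_isCusp_SL2Z] at hc
    have hγ {γ : SL(2, ℤ)} (hγ : γ ∈ Gamma0 11) :
        (g / etaQuotient : ℍ → ℂ) ∣[(0 : ℤ)] (mapGL ℝ γ) = g / etaQuotient := by
      have := div_slash_SL2 2 2 γ g etaQuotient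
      rwa [slash_eq_self g hγ, etaQuotient_slash hγ] at this
    obtain ⟨γ, hγ', rfl | rfl⟩ := exists_mem_Gamma0_cusp_eq hc
    · rw [OnePoint.IsBoundedAt.smul_iff, OnePoint.isBoundedAt_infty_iff, hγ hγ']
      exact (div_isBoundedUnder_of_isBigO
        ((isBigO_exp g).trans exp_isBigO_etaQuotient)).isBigO_one ℝ
    · rw [OnePoint.IsBoundedAt.smul_iff, OnePoint.IsBoundedAt.smul_iff,
        OnePoint.isBoundedAt_infty_iff, hγ hγ']
      have := div_slash_SL2 2 2 ModularGroup.S g etaQuotient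
      rw [sub_self] at this
      refine this ▸ (div_isBoundedUnder_of_isBigO
        ((slash_S_isBigO_exp g).trans exp_isBigO_etaQuotient_slash_S)).isBigO_one ℝ

lemma exists_smul_etaForm_eq (g : CuspSpace 11 2) : ∃ c : ℂ, c • etaForm = g := by
  obtain ⟨c, hc⟩ := ModularForm.eq_const_of_weight_zero (divEtaForm g)
  refine ⟨c, CuspForm.ext fun τ ↦ ?_⟩
  have h : g τ / etaQuotient τ = c := congrFun hc τ
  rw [div_eq_iff (etaQuotient_ne_zero τ)] at h
  exact h.symm

lemma etaForm_ne_zero : etaForm ≠ 0 := fun h ↦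
  etaQuotient_ne_zero UpperHalfPlane.I (DFunLike.congr_fun h UpperHalfPlane.I)

lemma finrank_cuspSpace_eleven_two : Module.finrank ℂ (CuspSpace 11 2) = 1 :=
  finrank_eq_one etaForm etaForm_ne_zero exists_smul_etaForm_eq

end Growth

/-! ### Hecke operators preserve cusp forms -/

section Hecke

open ModularForm Matrix.SpecialLinearGroup
open scoped Manifold

/-- An integral `2 × 2` matrix of nonzero determinant as an element of `GL₂(ℝ)`; matrices of
determinant `0` are sent to `1`. -/
def intGL (A : Matrix (Fin 2) (Fin 2) ℤ) : GL (Fin 2) ℝ :=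
  if h : (A.map (Int.cast : ℤ → ℝ)).det ≠ 0 then Matrix.GeneralLinearGroup.mkOfDetNeZero _ h else 1

lemma coe_intGL {A : Matrix (Fin 2) (Fin 2) ℤ} (hA : A.det ≠ 0) :
    (intGL A : Matrix (Fin 2) (Fin 2) ℝ) = A.map (Int.cast : ℤ → ℝ) := by
  have h : (A.map (Int.cast : ℤ → ℝ)).det ≠ 0 := by
    have : (A.map (Int.cast : ℤ → ℝ)).det = (A.det : ℝ) := ((Int.castRingHom ℝ).map_det A).symm
    rw [this]
    exact_mod_cast hA
  rw [intGL, dif_pos h]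
  rfl

lemma intGL_mul {A B : Matrix (Fin 2) (Fin 2) ℤ} (hA : A.det ≠ 0) (hB : B.det ≠ 0) :
    intGL (A * B) = intGL A * intGL B := by
  refine Units.ext ?_
  rw [Units.val_mul, coe_intGL hA, coe_intGL hB,
    coe_intGL (by rw [Matrix.det_mul]; exact mul_ne_zero hA hB)]
  exact Matrix.map_mul (f := Int.castRingHom ℝ)

lemma intGL_coe (γ : SL(2, ℤ)) : intGL γ = mapGL ℝ γ := by
  refine Units.ext ?_
  rw [coe_intGL (by simp), mapGL_coe_matrix]
  rfl

/-- Hermite normal form for integral matrices whose lower left entry is divisible by `N` and whose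
upper left entry is prime to `N`, under multiplication by `Γ₀(N)` from the left. -/
lemma exists_hermite {N n : ℕ} (hn : 0 < n) {A : Matrix (Fin 2) (Fin 2) ℤ} (hdet : A.det = n)
    (hN : (N : ℤ) ∣ A 1 0) (hco : IsCoprime (A 0 0) (N : ℤ)) :
    ∃ γ ∈ Gamma0 N, ∃ a b d : ℕ, a * d = n ∧ Nat.Coprime a N ∧ b < d ∧
      A = (γ : Matrix (Fin 2) (Fin 2) ℤ) * !![(a : ℤ), b; 0, d] := by
  rw [Matrix.det_fin_two] at hdet
  have hne : ¬(A 0 0 = 0 ∧ A 1 0 = 0) := by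
    rintro ⟨h1, h2⟩
    rw [h1, h2] at hdet
    simp at hdet
    omega
  have hg : 0 < Int.gcd (A 0 0) (A 1 0) := by
    rw [Nat.pos_iff_ne_zero, Ne, Int.gcd_eq_zero_iff]
    exact hne
  obtain ⟨x, hx⟩ := Int.gcd_dvd_left (a := A 0 0) (b := A 1 0)
  obtain ⟨z, hz⟩ := Int.gcd_dvd_right (a := A 0 0) (b := A 1 0)
  have hbez := Int.gcd_eq_gcd_ab (A 0 0) (A 1 0)
  set a := Int.gcd (A 0 0) (A 1 0) with ha
  set w := Int.gcdA (A 0 0) (A 1 0)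
  set y := Int.gcdB (A 0 0) (A 1 0)
  have ha0 : (a : ℤ) ≠ 0 := by exact_mod_cast hg.ne'
  have hxz : x * w + z * y = 1 := by
    have : (a : ℤ) * (x * w + z * y) = a * 1 := by
      rw [mul_one]
      conv_rhs => rw [hbez, hx, hz]
      ring
    exact mul_left_cancel₀ ha0 this
  have hcoa : IsCoprime (a : ℤ) (N : ℤ) := hco.of_isCoprime_of_dvd_left ⟨x, hx⟩
  have hNz : (N : ℤ) ∣ z := by
    rw [hz] at hN
    exact hcoa.symm.dvd_of_dvd_mul_left hN
  -- `b₀` and `d` are the entries of the second column after clearing the lower left entry.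
  set b₀ := w * A 0 1 + y * A 1 1
  set d := -z * A 0 1 + x * A 1 1
  have had : (a : ℤ) * d = n := by
    rw [← hdet]
    linear_combination -A 1 1 * hx + A 0 1 * hz
  have hd : 0 < d := by
    have hn' : (0 : ℤ) < n := by exact_mod_cast hn
    rw [← had] at hn'
    exact pos_of_mul_pos_right hn' (by positivity)
  obtain ⟨d', hd'⟩ := Int.eq_ofNat_of_zero_le hd.le
  obtain ⟨b, hb⟩ := Int.eq_ofNat_of_zero_le (Int.emod_nonneg b₀ hd.ne')
  -- A translation by `j` brings `b₀` into the range `0 ≤ b < d`.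
  set j := b₀ / d
  have hj : d * j + b = b₀ := by rw [← hb]; exact Int.mul_ediv_add_emod b₀ d
  refine ⟨⟨!![x, j * x - y; z, j * z + w], ?_⟩, mem_Gamma0_iff_dvd.2 (by simpa using hNz),
    a, b, d', ?_, Nat.isCoprime_iff_coprime.1 hcoa, ?_, ?_⟩
  · rw [Matrix.det_fin_two_of]
    linear_combination hxz
  · rw [hd'] at had
    exact_mod_cast had
  · have := Int.emod_lt_of_pos b₀ hd
    rw [hb, hd'] at this
    exact_mod_cast this
  · change A = !![x, j * x - y; z, j * z + w] * !![(a : ℤ), b; 0, d']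
    have h01 : A 0 1 = x * b + (j * x - y) * d := by
      linear_combination -A 0 1 * hxz - x * hj
    have h11 : A 1 1 = z * b + (j * z + w) * d := by
      linear_combination -A 1 1 * hxz - z * hj
    rw [hd'] at h01 h11
    ext i k
    fin_cases i <;> fin_cases k
    · simp [hx, mul_comm]
    · simpa using h01
    · simp [hz, mul_comm]
    · simpa using h11

/-- Uniqueness of the Hermite normal form: already the cosets of `SL₂(ℤ)` of distinct
representatives are distinct. -/
lemma hermite_unique {γ : SL(2, ℤ)} {a b d a' b' d' : ℕ} (ha : 0 < a) (ha' : 0 < a')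
    (hb : b < d) (hb' : b' < d')
    (h : !![(a : ℤ), b; 0, d] = (γ : Matrix (Fin 2) (Fin 2) ℤ) * !![(a' : ℤ), b'; 0, d']) :
    a = a' ∧ b = b' ∧ d = d' := by
  have hdet := det_entries γ
  have h00 : (a : ℤ) = γ 0 0 * a' := by
    simpa [Matrix.mul_apply, Fin.sum_univ_two] using congrFun (congrFun h 0) 0
  have h10 : γ 1 0 = 0 ∨ a' = 0 := by
    simpa [Matrix.mul_apply, Fin.sum_univ_two] using congrFun (congrFun h 1) 0
  have h01 : (b : ℤ) = γ 0 0 * b' + γ 0 1 * d' := by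
    simpa [Matrix.mul_apply, Fin.sum_univ_two] using congrFun (congrFun h 0) 1
  have h11 : (d : ℤ) = γ 1 0 * b' + γ 1 1 * d' := by
    simpa [Matrix.mul_apply, Fin.sum_univ_two] using congrFun (congrFun h 1) 1
  have hz : γ 1 0 = 0 := h10.resolve_right ha'.ne'
  have hx : 0 < γ 0 0 := by
    have : (0 : ℤ) < γ 0 0 * a' := by rw [← h00]; exact_mod_cast ha
    exact pos_of_mul_pos_left this (by positivity)
  rw [hz, mul_zero, sub_zero] at hdet
  have hx1 : γ 0 0 = 1 := by
    rcases Int.mul_eq_one_iff_eq_one_or_neg_one.1 hdet with h1 | h1 <;> omega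
  have hw1 : γ 1 1 = 1 := by rw [hx1] at hdet; linarith
  rw [hx1, one_mul] at h00 h01
  rw [hz, hw1, zero_mul, zero_add, one_mul] at h11
  have hd : d = d' := by exact_mod_cast h11
  subst hd
  have hy : γ 0 1 = 0 := by
    have hb1 : (b : ℤ) < d := by exact_mod_cast hb
    have hb2 : (b' : ℤ) < d := by exact_mod_cast hb'
    by_contra hne
    rcases lt_or_gt_of_ne hne with h1 | h1
    · have : γ 0 1 * d ≤ -1 * d := mul_le_mul_of_nonneg_right (by omega) (by positivity)
      omega
    · have : 1 * (d : ℤ) ≤ γ 0 1 * d := mul_le_mul_of_nonneg_right (by omega) (by positivity)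
      omega
  rw [hy, zero_mul, add_zero] at h01
  exact ⟨by exact_mod_cast h00, by exact_mod_cast h01, rfl⟩

/-- The representatives `(a, b; 0, d)`, with `ad = n`, `gcd(a, N) = 1` and `0 ≤ b < d`, of the
double coset defining `T_n` for `Γ₀(N)`, encoded as `⟨(a, d), b⟩`. -/
def heckeReps (N n : ℕ) : Finset (Σ _ : ℕ × ℕ, ℕ) :=
  ({p ∈ n.divisorsAntidiagonal | Nat.Coprime p.1 N}).sigma fun p ↦ Finset.range p.2

/-- The integral matrix `(a, b; 0, d)` encoded by `⟨(a, d), b⟩`. -/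
def repMatrix (r : Σ _ : ℕ × ℕ, ℕ) : Matrix (Fin 2) (Fin 2) ℤ := !![(r.1.1 : ℤ), r.2; 0, r.1.2]

lemma mem_heckeReps {N n : ℕ} {r : Σ _ : ℕ × ℕ, ℕ} : r ∈ heckeReps N n ↔
    (r.1.1 * r.1.2 = n ∧ n ≠ 0) ∧ Nat.Coprime r.1.1 N ∧ r.2 < r.1.2 := by
  simp [heckeReps, and_assoc]

lemma det_repMatrix {N n : ℕ} {r : Σ _ : ℕ × ℕ, ℕ} (hr : r ∈ heckeReps N n) :
    (repMatrix r).det = n := by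
  rw [repMatrix, Matrix.det_fin_two_of, ← (mem_heckeReps.1 hr).1.1]
  push_cast
  ring

lemma det_repMatrix_ne_zero {N n : ℕ} {r : Σ _ : ℕ × ℕ, ℕ} (hr : r ∈ heckeReps N n) :
    (repMatrix r).det ≠ 0 := by
  rw [det_repMatrix hr]
  exact_mod_cast (mem_heckeReps.1 hr).1.2

lemma exists_repMatrix_mul {N n : ℕ} {r : Σ _ : ℕ × ℕ, ℕ} (hr : r ∈ heckeReps N n)
    {γ : SL(2, ℤ)} (hγ : γ ∈ Gamma0 N) : ∃ s ∈ heckeReps N n, ∃ γ' ∈ Gamma0 N,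
      repMatrix r * (γ : Matrix (Fin 2) (Fin 2) ℤ) = γ' * repMatrix s := by
  obtain ⟨⟨hn, hn0⟩, hco, -⟩ := mem_heckeReps.1 hr
  have hN := mem_Gamma0_iff_dvd.1 hγ
  have hdet : (repMatrix r * (γ : Matrix (Fin 2) (Fin 2) ℤ)).det = n := by
    rw [Matrix.det_mul, det_repMatrix hr, γ.det_coe, mul_one]
  have e00 : (repMatrix r * (γ : Matrix (Fin 2) (Fin 2) ℤ)) 0 0 =
      r.1.1 * γ 0 0 + r.2 * γ 1 0 := by
    simp [repMatrix, Matrix.mul_apply, Fin.sum_univ_two]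
  have e10 : (repMatrix r * (γ : Matrix (Fin 2) (Fin 2) ℤ)) 1 0 = r.1.2 * γ 1 0 := by
    simp [repMatrix, Matrix.mul_apply, Fin.sum_univ_two]
  have hγco : IsCoprime (γ 0 0) (N : ℤ) := by
    have : IsCoprime (γ 0 0) (γ 1 0) := ⟨γ 1 1, -γ 0 1, by linarith [det_entries γ]⟩
    exact this.of_isCoprime_of_dvd_right hN
  obtain ⟨γ', hγ', a, b, d, had, haN, hbd, h⟩ := exists_hermite (Nat.pos_of_ne_zero hn0) hdet
    (e10 ▸ hN.mul_left _) (by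
      obtain ⟨t, ht⟩ := hN
      rw [e00, ht, mul_left_comm]
      exact (IsCoprime.mul_left (Nat.isCoprime_iff_coprime.2 hco) hγco).add_mul_left_left _)
  exact ⟨⟨(a, d), b⟩, mem_heckeReps.2 ⟨⟨had, hn0⟩, haN, hbd⟩, γ', hγ', h⟩

lemma repMatrix_injective {N n : ℕ} {r s : Σ _ : ℕ × ℕ, ℕ} (hr : r ∈ heckeReps N n)
    (hs : s ∈ heckeReps N n) {γ : SL(2, ℤ)}
    (h : repMatrix r = (γ : Matrix (Fin 2) (Fin 2) ℤ) * repMatrix s) : r = s := by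
  obtain ⟨⟨hn, hn0⟩, -, hb⟩ := mem_heckeReps.1 hr
  obtain ⟨⟨hn', -⟩, -, hb'⟩ := mem_heckeReps.1 hs
  have ha : 0 < r.1.1 := Nat.pos_of_ne_zero fun h0 ↦ hn0 (by rw [← hn, h0, zero_mul])
  have ha' : 0 < s.1.1 := Nat.pos_of_ne_zero fun h0 ↦ hn0 (by rw [← hn', h0, zero_mul])
  obtain ⟨h1, h2, h3⟩ := hermite_unique ha ha' hb hb' h
  obtain ⟨⟨a, d⟩, b⟩ := r
  obtain ⟨⟨a', d'⟩, b'⟩ := s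
  simp_all

lemma slash_repMatrix_apply {N n : ℕ} {r : Σ _ : ℕ × ℕ, ℕ} (hr : r ∈ heckeReps N n) (k : ℤ)
    (f : ℍ → ℂ) (τ : ℍ) : (f ∣[k] intGL (repMatrix r)) τ =
      (n : ℂ) ^ (k - 1) * ((r.1.2 : ℂ) ^ (-k) *
        f (ofComplex (((r.1.1 : ℂ) * τ + (r.2 : ℂ)) / (r.1.2 : ℂ)))) := by
  have hcoe := coe_intGL (det_repMatrix_ne_zero hr)
  have hdet : (intGL (repMatrix r)).det.val = (n : ℝ) := by
    have h1 : (intGL (repMatrix r)).det.val = ((repMatrix r).det : ℝ) := by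
      rw [Matrix.GeneralLinearGroup.val_det_apply, hcoe]
      exact ((Int.castRingHom ℝ).map_det (repMatrix r)).symm
    rw [h1, det_repMatrix hr]
    simp
  have hpos : 0 < (intGL (repMatrix r)).det.val := by
    rw [hdet]
    exact_mod_cast Nat.pos_of_ne_zero (mem_heckeReps.1 hr).1.2
  have hden : denom (intGL (repMatrix r)) τ = r.1.2 := by
    rw [denom, hcoe]
    simp [repMatrix]
  have hnum : num (intGL (repMatrix r)) τ = r.1.1 * τ + r.2 := by
    rw [num, hcoe]
    simp [repMatrix]
  have hsmul : intGL (repMatrix r) • τ =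
      ofComplex (((r.1.1 : ℂ) * τ + (r.2 : ℂ)) / (r.1.2 : ℂ)) := by
    rw [← hnum, ← hden, ← coe_smul_of_det_pos hpos, ofComplex_apply]
  rw [slash_apply, hsmul, hden, σ, if_pos hpos, hdet]
  simp
  ring

lemma heckeT_eq_sum (N : ℕ) (k : ℤ) (n : ℕ) (f : ℍ → ℂ) :
    heckeT N k n f = ∑ r ∈ heckeReps N n, f ∣[k] intGL (repMatrix r) := by
  ext τ
  rw [Finset.sum_apply, Finset.sum_congr rfl fun r hr ↦ slash_repMatrix_apply hr k f τ, heckeT,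
    heckeReps, Finset.sum_sigma, Finset.mul_sum]
  refine Finset.sum_congr rfl fun p _ ↦ ?_
  rw [Finset.mul_sum, Finset.mul_sum]

/-- Right multiplication by `γ ∈ Γ₀(N)` permutes the left cosets of `Γ₀(N)` that make up `T_n`. -/
lemma heckeT_slash {N : ℕ} {k : ℤ} (n : ℕ) (f : CuspSpace N k) {γ : SL(2, ℤ)}
    (hγ : γ ∈ Gamma0 N) : heckeT N k n f ∣[k] γ = heckeT N k n f := by
  classical
  choose! φ hφ ψ hψ hmul using fun r (hr : r ∈ heckeReps N n) ↦ exists_repMatrix_mul hr hγ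
  have hterm (r) (hr : r ∈ heckeReps N n) :
      ((f : ℍ → ℂ) ∣[k] intGL (repMatrix r)) ∣[k] γ = (f : ℍ → ℂ) ∣[k] intGL (repMatrix (φ r)) := by
    have hf : (f : ℍ → ℂ) ∣[k] (mapGL ℝ (ψ r)) = f :=
      SlashInvariantFormClass.slash_action_eq f _ ⟨ψ r, hψ r hr, rfl⟩
    rw [SL_slash, ← SlashAction.slash_mul]
    change (f : ℍ → ℂ) ∣[k] (intGL (repMatrix r) * mapGL ℝ γ) = _
    rw [← intGL_coe, ← intGL_mul (det_repMatrix_ne_zero hr) (by simp), hmul r hr,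
      intGL_mul (by simp) (det_repMatrix_ne_zero (hφ r hr)), SlashAction.slash_mul, intGL_coe, hf]
  have hinj : Set.InjOn φ (heckeReps N n) := by
    intro r hr s hs hrs
    have h1 := hmul r hr
    rw [hrs] at h1
    have h2 : repMatrix r * (γ : Matrix (Fin 2) (Fin 2) ℤ) =
        (ψ r * (ψ s)⁻¹ : SL(2, ℤ)) * repMatrix s * (γ : Matrix (Fin 2) (Fin 2) ℤ) := by
      rw [Matrix.mul_assoc, hmul s hs, h1, ← Matrix.mul_assoc, ← Matrix.SpecialLinearGroup.coe_mul,
        inv_mul_cancel_right]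
    refine repMatrix_injective hr hs (γ := ψ r * (ψ s)⁻¹) ?_
    have h3 := congrArg (· * ((γ⁻¹ : SL(2, ℤ)) : Matrix (Fin 2) (Fin 2) ℤ)) h2
    simpa only [Matrix.mul_assoc, ← Matrix.SpecialLinearGroup.coe_mul γ, mul_inv_cancel,
      Matrix.SpecialLinearGroup.coe_one, Matrix.mul_one] using h3
  rw [heckeT_eq_sum, SlashAction.sum_slash, Finset.sum_congr rfl hterm]
  exact Finset.sum_nbij φ hφ hinj (Finset.surjOn_of_injOn_of_card_le φ hφ hinj le_rfl)
    fun _ _ ↦ rfl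

/-- The Hecke operator `T_n` on `S_k(Γ₀(N))`. -/
def heckeForm {N : ℕ} [NeZero N] {k : ℤ} (n : ℕ) (f : CuspSpace N k) : CuspSpace N k where
  toFun := heckeT N k n f
  slash_action_eq' := by
    rintro _ ⟨γ, hγ, rfl⟩
    exact heckeT_slash n f hγ
  holo' := by
    change MDiff (heckeT N k n f)
    rw [heckeT_eq_sum]
    exact .sum fun r _ ↦ (CuspFormClass.holo f).slash k _
  zero_at_cusps' {c} hc := by
    have hcusp (c : OnePoint ℝ) := Subgroup.IsArithmetic.isCusp_iff_isCusp_SL2Z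
      ((Gamma0 N : Subgroup SL(2, ℤ)) : Subgroup (GL (Fin 2) ℝ)) (c := c)
    rw [hcusp] at hc
    obtain ⟨g, rfl⟩ := isCusp_SL2Z_iff'.1 hc
    rw [OnePoint.IsZeroAt.smul_iff, OnePoint.isZeroAt_infty_iff]
    change IsZeroAtImInfty (heckeT N k n f ∣[k] mapGL ℝ g)
    rw [heckeT_eq_sum, SlashAction.sum_slash]
    -- Each summand is a translate of `f` by some `γ` in `SL₂(ℤ)`, followed by an upper triangular
    -- matrix: this is the Hermite normal form for level `1`.
    have hterm (r) (hr : r ∈ heckeReps N n) :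
        IsZeroAtImInfty (((f : ℍ → ℂ) ∣[k] intGL (repMatrix r)) ∣[k] mapGL ℝ g) := by
      have hr1 : r ∈ heckeReps 1 n := by
        rw [mem_heckeReps] at hr ⊢
        exact ⟨hr.1, Nat.coprime_one_right _, hr.2.2⟩
      obtain ⟨s, hs, γ, -, h⟩ := exists_repMatrix_mul hr1 (γ := g)
        (mem_Gamma0_iff_dvd.2 (by simp))
      rw [← SlashAction.slash_mul, ← intGL_coe,
        ← intGL_mul (det_repMatrix_ne_zero hr) (by simp), h,
        intGL_mul (by simp) (det_repMatrix_ne_zero hs), SlashAction.slash_mul, intGL_coe]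
      refine IsZeroAtImInfty.slash _ ?_ ?_
      · rw [coe_intGL (det_repMatrix_ne_zero hs)]
        simp [repMatrix]
      · exact CuspFormClass.zero_at_cusps f ((hcusp _).2 (isCusp_SL2Z_iff'.2 ⟨γ, rfl⟩)) _ rfl
    have := tendsto_finsetSum (heckeReps N n) hterm
    rw [Finset.sum_const_zero] at this
    exact this.congr fun τ ↦ by rw [Finset.sum_apply]

/-- Every Hecke operator maps the one-dimensional space `S₂(Γ₀(11))` to itself. -/
lemma exists_heckeT_etaForm_eq (n : ℕ) :
    ∃ c : ℂ, ∀ τ : ℍ, heckeT 11 2 n etaForm τ = c * etaForm τ := by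
  obtain ⟨c, hc⟩ := exists_smul_etaForm_eq (heckeForm n etaForm)
  exact ⟨c, fun τ ↦ (DFunLike.congr_fun hc τ).symm⟩

end Hecke

/-! ### Integrality of the Fourier coefficients -/

section Integrality

open Complex ModularForm Filter Metric
open scoped Real Topology

/-- The Taylor coefficients at `0` of a locally uniform limit of integral polynomials are
integers: they are limits of integers. -/
lemma exists_int_eq_taylor_coeff {P : ℕ → Polynomial ℤ} {f : ℂ → ℂ}
    (h : TendstoLocallyUniformlyOn (fun N q ↦ ((P N).map (Int.castRingHom ℂ)).eval q) f atTop
      (ball 0 1)) (m : ℕ) : ∃ a : ℤ, (m.factorial : ℂ)⁻¹ * iteratedDeriv m f 0 = a := by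
  have h1 (m : ℕ) : TendstoLocallyUniformlyOn (fun N q ↦
      (Polynomial.derivative^[m] ((P N).map (Int.castRingHom ℂ))).eval q)
      (iteratedDeriv m f) atTop (ball 0 1) := by
    induction m with
    | zero => simpa using h
    | succ m ih =>
      rw [iteratedDeriv_succ]
      refine (ih.deriv (.of_forall fun N ↦ (Polynomial.differentiable _).differentiableOn)
        isOpen_ball).congr fun N q _ ↦ ?_
      simp only [Function.comp_apply, Polynomial.deriv, Function.iterate_succ_apply']
  have h2 := ((h1 m).tendsto_at (mem_ball_self one_pos)).const_mul (m.factorial : ℂ)⁻¹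
  have hcl : IsClosed (Set.range (Int.cast : ℤ → ℂ)) :=
    Complex.isClosedEmbedding_intCast.isClosed_range
  have hint (N : ℕ) : (m.factorial : ℂ)⁻¹ *
      (Polynomial.derivative^[m] ((P N).map (Int.castRingHom ℂ))).eval 0 ∈
        Set.range (Int.cast : ℤ → ℂ) := by
    refine ⟨(P N).coeff m, ?_⟩
    have : (m.factorial : ℂ) ≠ 0 := by exact_mod_cast m.factorial_ne_zero
    rw [← Polynomial.coeff_zero_eq_eval_zero, Polynomial.coeff_iterate_derivative]
    simp [Nat.descFactorial_self, this]
  obtain ⟨a, ha⟩ := hcl.mem_of_tendsto h2 (.of_forall hint)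
  exact ⟨a, ha.symm⟩

/-- The Euler product `∏ (1 - q ^ (n + 1))`. -/
def eulerProd (q : ℂ) : ℂ := ∏' n : ℕ, (1 - q ^ (n + 1))

lemma tendsto_eulerProd : TendstoLocallyUniformlyOn
    (fun (N : ℕ) q ↦ ∏ n ∈ Finset.range N, (1 - q ^ (n + 1))) eulerProd atTop (ball 0 1) :=
  multipliableLocallyUniformlyOn_one_sub_pow.hasProdLocallyUniformlyOn
    |>.tendstoLocallyUniformlyOn_finsetRange

lemma differentiableOn_eulerProd : DifferentiableOn ℂ eulerProd (ball 0 1) :=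
  differentiableOn_tprod_one_sub_pow

lemma mapsTo_pow_eleven : Set.MapsTo (fun q : ℂ ↦ q ^ 11) (ball 0 1) (ball 0 1) := by
  intro q hq
  rw [mem_ball_zero_iff] at hq ⊢
  rw [norm_pow]
  exact pow_lt_one₀ (norm_nonneg _) hq (by norm_num)

lemma differentiableOn_eulerProd_pow_eleven :
    DifferentiableOn ℂ (fun q ↦ eulerProd (q ^ 11)) (ball 0 1) :=
  differentiableOn_eulerProd.comp (by fun_prop) mapsTo_pow_eleven

lemma eulerProd_zero : eulerProd 0 = 1 := by
  simp [eulerProd]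

/-- Partial products of `q ∏ (1 - qⁿ)² (1 - q¹¹ⁿ)²`. -/
def etaPoly (N : ℕ) : Polynomial ℤ :=
  Polynomial.X * ((∏ n ∈ Finset.range N, (1 - Polynomial.X ^ (n + 1))) ^ 2 *
    (∏ n ∈ Finset.range N, (1 - (Polynomial.X ^ 11) ^ (n + 1))) ^ 2)

lemma tendsto_etaPoly : TendstoLocallyUniformlyOn
    (fun N q ↦ ((etaPoly N).map (Int.castRingHom ℂ)).eval q)
    (fun q ↦ q * (eulerProd q ^ 2 * eulerProd (q ^ 11) ^ 2)) atTop (ball 0 1) := by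
  have c1 := differentiableOn_eulerProd.continuousOn
  have c2 := differentiableOn_eulerProd_pow_eleven.continuousOn
  have h1 := tendsto_eulerProd
  have h2 := tendsto_eulerProd.comp _ mapsTo_pow_eleven (by fun_prop)
  have h0 : TendstoLocallyUniformlyOn (fun (_ : ℕ) (q : ℂ) ↦ q) (fun q ↦ q) atTop (ball 0 1) :=
    fun u hu q _ ↦ ⟨Set.univ, univ_mem, .of_forall fun _ _ _ ↦ refl_mem_uniformity hu⟩
  have h := h0.mul₀ ((h1.mul₀ h1 c1 c1).mul₀ (h2.mul₀ h2 c2 c2) (c1.mul c1) (c2.mul c2))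
    continuousOn_id ((c1.mul c1).mul (c2.mul c2))
  refine (h.congr fun N q _ ↦ ?_).congr_right fun q _ ↦ ?_
  · simp [etaPoly, Polynomial.eval_prod, Polynomial.map_prod, sq]
  · simp [sq]

lemma etaSq_eq_prod (τ : ℍ) : etaSq τ = Function.Periodic.qParam 12 τ *
    eulerProd (Function.Periodic.qParam 1 τ) ^ 2 := by
  rw [etaSq, ModularForm.eta, mul_pow]
  congr 1
  rw [Function.Periodic.qParam, Function.Periodic.qParam, ← exp_nat_mul]
  congr 1
  push_cast
  ring

lemma etaQuotient_eq_prod (τ : ℍ) : etaQuotient τ = Function.Periodic.qParam 1 τ *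
    (eulerProd (Function.Periodic.qParam 1 τ) ^ 2 *
      eulerProd (Function.Periodic.qParam 1 τ ^ 11) ^ 2) := by
  have h1 : Function.Periodic.qParam 1 (scale11 τ) = Function.Periodic.qParam 1 τ ^ 11 := by
    rw [Function.Periodic.qParam, Function.Periodic.qParam, ← exp_nat_mul, coe_scale11]
    congr 1
    push_cast
    ring
  have h2 : Function.Periodic.qParam 12 τ * Function.Periodic.qParam 12 (scale11 τ) =
      Function.Periodic.qParam 1 τ := by
    rw [Function.Periodic.qParam, Function.Periodic.qParam, Function.Periodic.qParam, ← exp_add,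
      coe_scale11]
    congr 1
    push_cast
    ring
  rw [etaQuotient, etaSq_eq_prod, etaSq_eq_prod, h1, ← h2]
  ring

lemma cuspFunction_etaForm_eqOn : Set.EqOn (cuspFunction 1 etaForm)
    (fun q ↦ q * (eulerProd q ^ 2 * eulerProd (q ^ 11) ^ 2)) (ball 0 1) := by
  intro q hq
  by_cases hq0 : q = 0
  · simpa [hq0] using! Function.Periodic.cuspFunction_zero_of_zero_at_inf one_pos
      isZeroAtImInfty_etaQuotient.zero_at_infty_comp_ofComplex
  · have him := Function.Periodic.im_invQParam_pos_of_norm_lt_one one_pos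
      (by simpa [dist_zero_right] using hq) hq0
    rw [cuspFunction, Function.Periodic.cuspFunction_eq_of_nonzero 1 _ hq0, Function.comp_apply,
      ofComplex_apply_of_im_pos him, coe_etaForm, etaQuotient_eq_prod]
    simp [Function.Periodic.qParam_right_inv one_ne_zero hq0]

lemma fourierCoeff_etaForm_eq (n : ℕ) : fourierCoeff etaForm n = (n.factorial : ℂ)⁻¹ *
    iteratedDeriv n (fun q ↦ q * (eulerProd q ^ 2 * eulerProd (q ^ 11) ^ 2)) 0 := by
  rw [fourierCoeff, qExpansion_coeff]
  congr 1
  refine Filter.EventuallyEq.iteratedDeriv_eq _ ?_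
  exact cuspFunction_etaForm_eqOn.eventuallyEq_of_mem (ball_mem_nhds 0 one_pos)

lemma exists_int_fourierCoeff_etaForm (n : ℕ) : ∃ a : ℤ, fourierCoeff etaForm n = a := by
  rw [fourierCoeff_etaForm_eq]
  exact exists_int_eq_taylor_coeff tendsto_etaPoly n

lemma fourierCoeff_etaForm_one : fourierCoeff etaForm 1 = 1 := by
  have h0 : ball (0 : ℂ) 1 ∈ 𝓝 0 := ball_mem_nhds 0 one_pos
  have h1 := differentiableOn_eulerProd.differentiableAt h0
  have h2 := differentiableOn_eulerProd_pow_eleven.differentiableAt h0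
  have h := (hasDerivAt_id (0 : ℂ)).mul ((h1.pow 2).mul (h2.pow 2)).hasDerivAt
  rw [fourierCoeff_etaForm_eq, iteratedDeriv_one]
  have h' := h.deriv
  simp only [id, zero_mul, add_zero, one_mul, Pi.mul_apply, Pi.pow_apply] at h'
  simp only [Nat.factorial_one, Nat.cast_one, inv_one, one_mul]
  refine h'.trans ?_
  simp [eulerProd_zero]

end Integrality

/-! ### Old forms and newforms of level `11` -/

section Newform

open ModularForm

lemma coe_Gamma0_one : ((Gamma0 1 : Subgroup SL(2, ℤ)) : Subgroup (GL (Fin 2) ℝ)) = 𝒮ℒ := by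
  have : Gamma0 1 = ⊤ := eq_top_iff.2 fun γ _ ↦ mem_Gamma0_iff_dvd.2 (by simp)
  rw [this, MonoidHom.range_eq_map]

lemma cuspForm_levelOne_eq_zero (g : CuspSpace 1 2) (τ : ℍ) : g τ = 0 := by
  have h := rank_zero_iff.1 (CuspForm.rank_eq_zero_of_weight_lt_twelve (k := 2) (by norm_num))
  exact DFunLike.congr_fun (h.elim (g.copy g rfl coe_Gamma0_one.symm) 0) τ

/-- There are no old forms: `1` is the only proper divisor of `11`, and `S₂(SL₂(ℤ)) = 0`. -/
lemma oldSubspace_eleven_two : oldSubspace 11 2 = ⊥ := by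
  rw [oldSubspace, Submodule.span_eq_bot]
  rintro f ⟨M, hM, d, -, g, hg⟩
  rw [Nat.Prime.properDivisors (by norm_num), Finset.mem_singleton] at hM
  subst hM
  exact CuspForm.ext fun τ ↦ (hg τ).trans (cuspForm_levelOne_eq_zero g _)

lemma peterssonProduct_zero_left {N : ℕ} {k : ℤ} (f : CuspSpace N k) :
    peterssonProduct 0 f = 0 := by
  simp [peterssonProduct, petersson]

lemma isNewform_etaForm : IsNewform etaForm where
  normalized := fourierCoeff_etaForm_one
  eigenform n _ := exists_heckeT_etaForm_eq n
  new g hg := by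
    rw [oldSubspace_eleven_two, Submodule.mem_bot] at hg
    rw [hg, peterssonProduct_zero_left]

lemma eq_etaForm_of_fourierCoeff_one {g : CuspSpace 11 2} (hg : fourierCoeff g 1 = 1) :
    g = etaForm := by
  obtain ⟨c, rfl⟩ := exists_smul_etaForm_eq g
  have h : fourierCoeff (c • etaForm) 1 = c * fourierCoeff etaForm 1 := by
    have := ModularForm.qExpansion_smul (h := 1) one_pos (by simp) c etaForm
    rw [fourierCoeff, FunLike.coe_smul, this, PowerSeries.coeff_smul, smul_eq_mul, fourierCoeff]
  rw [h, fourierCoeff_etaForm_one, mul_one] at hg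
  rw [hg, one_smul]

lemma heckeField_etaForm : heckeField etaForm = ⊥ := by
  rw [heckeField, IntermediateField.adjoin_eq_bot_iff]
  rintro _ ⟨n, -, rfl⟩
  obtain ⟨a, ha⟩ := exists_int_fourierCoeff_etaForm n
  rw [ha]
  exact intCast_mem _ a

end Newform

end HeckeFieldX11

end

theorem mainTheorem12 :
    -- the data of the genus formula for `X₀(11)` and its value
    (Gamma0 11).index = 12 ∧
    HeckeFieldX11.numEllipticPoints 11 2 = 0 ∧
    HeckeFieldX11.numEllipticPoints 11 3 = 0 ∧
    HeckeFieldX11.numCusps 11 = 2 ∧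
    HeckeFieldX11.genusFormula 11 = 1 ∧
    -- the dimension equals this value
    (Module.finrank ℂ (HeckeFieldX11.CuspSpace 11 2) : ℚ) = HeckeFieldX11.genusFormula 11 ∧
    Module.finrank ℂ (HeckeFieldX11.CuspSpace 11 2) = 1 ∧
    -- the unique normalized newform, its integrality and its Hecke field
    ∃ f : HeckeFieldX11.CuspSpace 11 2,
      HeckeFieldX11.IsNewform f ∧
      (∀ g : HeckeFieldX11.CuspSpace 11 2, HeckeFieldX11.IsNewform g → g = f) ∧
      (∀ n : ℕ, ∃ a : ℤ, HeckeFieldX11.fourierCoeff f n = (a : ℂ)) ∧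
      HeckeFieldX11.heckeField f = ⊥ ∧
      Module.finrank ℚ (HeckeFieldX11.heckeField f) = 1 := by
  open HeckeFieldX11 in
  refine ⟨index_Gamma0_eleven, numEllipticPoints_eleven_eq_zero le_rfl,
    numEllipticPoints_eleven_eq_zero (by norm_num), numCusps_eleven, genusFormula_eleven, ?_,
    finrank_cuspSpace_eleven_two, etaForm, isNewform_etaForm,
    fun g hg ↦ eq_etaForm_of_fourierCoeff_one hg.normalized, exists_int_fourierCoeff_etaForm,
    heckeField_etaForm, ?_⟩
  · rw [finrank_cuspSpace_eleven_two, genusFormula_eleven, Nat.cast_one]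
  · rw [heckeField_etaForm]
    exact IntermediateField.finrank_bot
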